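/- A digraph $G$ is $k$-geodetic if for any two (not necessarily distinct) vertices $u,v$ there is at most one directed walk of length at most $k$ from $u$ to $v$ in $G$. Let $M(d,k)=1+d+d^2+\dots+d^k$ be the directed Moore bound. A $(d,k;+1)$-digraph is a finite $k$-geodetic digraph with minimum out-degree $d$ and order $M(d,k)+1$. Suppose that $k\ge 2$ is an integer such that (i) $k\equiv 3$ or $5 \pmod 6$, (ii) $k+2$ does not divide $\frac{M(3,k)-k-1}{2}$, and (iii) $M(3,k)+1$ is prime. Then there is no $(3,k;+1)$-digraph. In particular, there are no $(3,3;+1)$-, $(3,15;+1)$- or $(3,63;+1)$-digraphs. -/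

import Mathlib

namespace Digraph

variable {V : Type*}

/-- A directed walk from `u` to `v` in the digraph `G`: a (possibly empty) sequence of consecutive
arcs, in which vertices and arcs may be repeated. -/
inductive Walk (G : Digraph V) : V → V → Type _
  | nil {u : V} : Walk G u u
  | cons {u v w : V} (h : G.Adj u v) (p : Walk G v w) : Walk G u w

/-- The length of a walk, i.e. its number of arcs. -/
def Walk.length {G : Digraph V} : {u v : V} → G.Walk u v → ℕ
  | _, _, .nil => 0
  | _, _, .cons _ p => p.length + 1

/-- A digraph is `k`-geodetic if for any two (not necessarily distinct) vertices `u`, `v` there is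
at most one directed walk of length at most `k` from `u` to `v`. (For `1 ≤ k` this excludes
loops.) -/
def IsGeodetic (G : Digraph V) (k : ℕ) : Prop :=
  ∀ (u v : V) (p q : G.Walk u v), p.length ≤ k → q.length ≤ k → p = q

/-- The out-degree of a vertex (used for finite digraphs only). -/
noncomputable def outDegree (G : Digraph V) (u : V) : ℕ :=
  {v : V | G.Adj u v}.ncard

/-- `G` has minimum out-degree equal to `d`. -/
def HasMinOutDegree (G : Digraph V) (d : ℕ) : Prop :=
  IsLeast (Set.range G.outDegree) d

/-- The directed Moore bound `M(d,k) = 1 + d + d ^ 2 + ⋯ + d ^ k`. -/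
def mooreBound (d k : ℕ) : ℕ :=
  ∑ i ∈ Finset.range (k + 1), d ^ i

/-- A `(d,k;+1)`-digraph: a finite `k`-geodetic digraph with minimum out-degree `d` whose order
exceeds the directed Moore bound by one. -/
structure IsExcessOne (G : Digraph V) (d k : ℕ) : Prop where
  finite : Finite V
  geodetic : G.IsGeodetic k
  minOutDegree : G.HasMinOutDegree d
  order : Nat.card V = mooreBound d k + 1

end Digraph

/-! Let A be the adjacency matrix and S = I + A + ⋯ + A^k. Counting walks shows that every
out-degree is d and that each vertex u reaches, within k steps, all vertices but one, its outlier `o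
u`. Hence S = J - P, with P the 0-1 matrix of `o`. A trace computation shows that in-degrees are d
as well (`sum_col_eq`); then P commutes with A, and `o` is an automorphism without fixed points
(`IsOutlierMap.apply_apply`).

For d = 3, consider an automorphism that commutes with `o` and fixes a vertex. Its fixed vertices
span a subdigraph obeying the same walk count, so there are 2, k + 2 or all of them
(`fixedVertices_trichotomy`). Let s be the least cycle length of `o`. Applied to `o ^ s`, the
trichotomy shows in each case that s divides every cycle length of `o`, hence the order; the case of
two fixed vertices needs 3 ∤ k + 2, which the congruence on k supplies. Since s > 1 and the order is
prime, `o` is a single cycle. Then two-step walks commute, which contradicts geodecity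
(`not_exists_pow_apply`). -/

/-! ### Traces of matrices with B^(k+2) = B. -/

section FiniteOrderTrace

open scoped Matrix

variable {n : Type*} [Fintype n] [DecidableEq n]

/-- A real matrix of finite order has the same trace as its inverse. -/
theorem Matrix.trace_pow_eq_of_pow_succ_eq_one (C : Matrix n n ℝ) (m : ℕ) (h : C ^ (m + 1) = 1) :
    (C ^ m).trace = C.trace := by
  -- Averaging over the cyclic group gives a positive definite form invariant under `C`, so the
  -- inverse `C ^ m` equals Q⁻¹ Cᵀ Q, a conjugate of Cᵀ.
  set Q : Matrix n n ℝ := ∑ i ∈ Finset.range (m + 1), (C ^ i)ᵀ * C ^ i with hQ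
  have hinv : Cᵀ * Q * C = Q := by
    have h1 : Cᵀ * Q * C = ∑ i ∈ Finset.range (m + 1), (C ^ (i + 1))ᵀ * C ^ (i + 1) := by
      rw [hQ, Finset.mul_sum, Finset.sum_mul]
      refine Finset.sum_congr rfl fun i _ => ?_
      rw [pow_succ, Matrix.transpose_mul]
      simp only [Matrix.mul_assoc]
    rw [h1, Finset.sum_range_succ, h, hQ, Finset.sum_range_succ']
    simp
  have hpos : Q.PosDef := by
    rw [hQ, Finset.sum_range_succ']
    refine Matrix.PosDef.posSemidef_add (Matrix.posSemidef_sum _ fun i _ => ?_) ?_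
    · simpa using Matrix.posSemidef_conjTranspose_mul_self (C ^ (i + 1))
    · simpa using Matrix.PosDef.one
  have hu : IsUnit Q.det := (Matrix.isUnit_iff_isUnit_det Q).1 hpos.isUnit
  have h2 : Q * C ^ m = Cᵀ * Q := by
    calc Q * C ^ m = Cᵀ * Q * C * C ^ m := by rw [hinv]
      _ = Cᵀ * Q := by rw [Matrix.mul_assoc, ← pow_succ', h, Matrix.mul_one]
  have h3 : C ^ m = Q⁻¹ * (Cᵀ * Q) := by
    rw [← h2, ← Matrix.mul_assoc, Matrix.nonsing_inv_mul _ hu, Matrix.one_mul]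
  rw [h3, Matrix.trace_mul_comm, Matrix.mul_assoc, Matrix.mul_nonsing_inv _ hu, Matrix.mul_one,
    Matrix.trace_transpose]

/-- `B ^ (k + 1)` is idempotent, and `B` has finite order on its image. Adding the complementary
projection `1 - B ^ (k + 1)` gives a matrix of finite order, and shifts both traces equally. -/
theorem Matrix.trace_pow_eq_of_pow_add_two_eq (B : Matrix n n ℝ) (k : ℕ) (hk : 1 ≤ k)
    (h : B ^ (k + 2) = B) : (B ^ k).trace = B.trace := by
  have hBE : B * B ^ (k + 1) = B := by rw [← pow_succ', h]
  have hEB : B ^ (k + 1) * B = B := by rw [← pow_succ, h]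
  have hEE : B ^ (k + 1) * B ^ (k + 1) = B ^ (k + 1) := by
    conv_lhs => rw [pow_succ (n := k), Matrix.mul_assoc, ← pow_succ (n := k), hBE]
    rw [pow_succ]
  have hpow : ∀ j : ℕ, (B + 1 - B ^ (k + 1)) ^ (j + 1) = B ^ (j + 1) + 1 - B ^ (k + 1) := by
    intro j
    induction j with
    | zero => simp
    | succ j ih =>
      have h4 : B ^ (j + 1) * B ^ (k + 1) = B ^ (j + 1) := by
        rw [pow_succ (n := j), Matrix.mul_assoc, hBE]
      rw [pow_succ, ih]
      simp only [Matrix.mul_add, Matrix.mul_sub, Matrix.add_mul, Matrix.sub_mul, h4, hEB, hEE,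
        Matrix.mul_one, Matrix.one_mul, ← pow_succ]
      abel
  have h1 := Matrix.trace_pow_eq_of_pow_succ_eq_one (B + 1 - B ^ (k + 1)) k (by rw [hpow]; abel)
  obtain ⟨j, rfl⟩ : ∃ j, k = j + 1 := ⟨k - 1, by omega⟩
  rw [hpow] at h1
  simp only [Matrix.trace_add, Matrix.trace_sub] at h1
  linarith

/-- A real matrix with constant row sum `d`, such that `A ^ (k + 2) - A` has constant columns and
the traces of `A` and `A ^ k` vanish, satisfies `d ^ k = d`. -/
theorem Matrix.pow_eq_of_pow_add_two_sub_const (A : Matrix n n ℝ) [Nonempty n] (k : ℕ) (d : ℝ)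
    (hd : 1 < d) (hk : 1 ≤ k) (hrow : ∀ u, ∑ v, A u v = d) (g : n → ℝ)
    (hg : ∀ u v, (A ^ (k + 2)) u v = A u v + g v) (h1 : A.trace = 0) (hkt : (A ^ k).trace = 0) :
    d ^ k = d := by
  set D : ℝ := d ^ (k + 2) - d with hD
  have hDpos : D ≠ 0 := by
    have : d ^ 1 < d ^ (k + 2) := pow_lt_pow_right₀ hd (by omega)
    rw [pow_one] at this
    rw [hD]; linarith
  -- `H` is the rank-one projection onto constant vectors; `D` is the common row sum of `A ^ (k + 2)
  -- - A`. Subtracting `d • H` removes the eigenvalue d, leaving traces -d and -d^k for the powers 1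
  -- and k.
  set H : Matrix n n ℝ := Matrix.of fun _ v => g v / D with hH
  have hGH : A ^ (k + 2) - A = D • H := by
    ext u v
    simp only [Matrix.sub_apply, hg, Matrix.smul_apply, hH, Matrix.of_apply, smul_eq_mul]
    field_simp
    ring
  have hAH : A * H = d • H := by
    ext u v
    simp only [Matrix.mul_apply, hH, Matrix.of_apply, Matrix.smul_apply, smul_eq_mul]
    rw [← Finset.sum_mul, hrow]
  -- `D • H` is a polynomial in `A`, so it commutes with `A`; no column sums are needed.
  have hHA : H * A = d • H := by
    have : D • (H * A) = D • (d • H) := by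
      rw [← hAH, ← Matrix.smul_mul, ← Matrix.mul_smul, ← hGH, Matrix.mul_sub, Matrix.sub_mul,
        ← pow_succ, ← pow_succ']
    exact smul_right_injective _ hDpos this
  have hApow : ∀ j, A ^ j * H = d ^ j • H := by
    intro j
    induction j with
    | zero => simp
    | succ j ih => rw [pow_succ, Matrix.mul_assoc, hAH, Matrix.mul_smul, ih, smul_smul, pow_succ']
  have hsum : ∀ j u, ∑ v, (A ^ j) u v = d ^ j := by
    intro j
    induction j with
    | zero => intro u; simp [Matrix.one_apply]
    | succ j ih =>
      intro u
      simp only [pow_succ', Matrix.mul_apply]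
      rw [Finset.sum_comm]
      simp only [← Finset.mul_sum, ih]
      rw [← Finset.sum_mul, hrow]
  have hgsum : ∑ v, g v = D := by
    obtain ⟨u⟩ := ‹Nonempty n›
    have := hsum (k + 2) u
    simp only [hg, Finset.sum_add_distrib, hrow] at this
    rw [hD]; linarith
  have hHtr : H.trace = 1 := by
    simp only [Matrix.trace, Matrix.diag, hH, Matrix.of_apply]
    rw [← Finset.sum_div, hgsum, div_self hDpos]
  have hHH : H * H = H := by
    ext u v
    simp only [Matrix.mul_apply, hH, Matrix.of_apply]
    rw [← Finset.sum_mul, ← Finset.sum_div, hgsum, div_self hDpos, one_mul]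
  have hpow : ∀ j, (A - d • H) ^ (j + 1) = A ^ (j + 1) - d ^ (j + 1) • H := by
    intro j
    induction j with
    | zero => simp
    | succ j ih =>
      rw [pow_succ, ih]
      simp only [Matrix.mul_sub, Matrix.sub_mul, Matrix.mul_smul, Matrix.smul_mul, hApow, hHA, hHH,
        smul_smul, ← pow_succ]
      simp
  have hB : (A - d • H) ^ (k + 2) = A - d • H := by
    rw [hpow (k + 1), sub_eq_sub_iff_sub_eq_sub, hGH, hD, sub_smul]
  have key := Matrix.trace_pow_eq_of_pow_add_two_eq _ k hk hB
  obtain ⟨j, rfl⟩ : ∃ j, k = j + 1 := ⟨k - 1, by omega⟩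
  rw [hpow] at key
  simp only [Matrix.trace_sub, Matrix.trace_smul, hHtr, h1, hkt, smul_eq_mul] at key
  linarith

end FiniteOrderTrace

/-! ### Walk counts as entries of powers of the adjacency matrix. -/

namespace Digraph

section AdjacencyMatrix

variable {V : Type*}

open Classical in
/-- The adjacency matrix of a digraph, with entries in `ℕ`. -/
noncomputable def natAdjMatrix (G : Digraph V) : Matrix V V ℕ :=
  Matrix.of fun u v => if G.Adj u v then 1 else 0

def walkSuccEquiv (G : Digraph V) (i : ℕ) (u v : V) :
    {p : G.Walk u v // p.length = i + 1} ≃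
      Σ x : {x // G.Adj u x}, {p : G.Walk x v // p.length = i} where
  toFun
    | ⟨.cons h p, hp⟩ => ⟨⟨_, h⟩, p, Nat.succ.inj hp⟩
  invFun
    | ⟨⟨_, h⟩, p, hp⟩ => ⟨.cons h p, congrArg Nat.succ hp⟩
  left_inv
    | ⟨.cons _ _, _⟩ => rfl
  right_inv
    | ⟨⟨_, _⟩, _, _⟩ => rfl

theorem walk_length_eq_zero {G : Digraph V} {u v : V} (p : G.Walk u v) (hp : p.length = 0) :
    u = v := by
  cases p with
  | nil => rfl
  | cons h p => simp [Walk.length] at hp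

theorem sum_natAdjMatrix_eq_outDegree [Fintype V] (G : Digraph V) (u : V) :
    ∑ v, G.natAdjMatrix u v = G.outDegree u := by
  classical
  simp [natAdjMatrix, outDegree, Set.ncard_eq_toFinset_card']

variable [Fintype V] [DecidableEq V]

theorem finite_walks_and_card (G : Digraph V) (i : ℕ) (u v : V) :
    Finite {p : G.Walk u v // p.length = i} ∧
      Nat.card {p : G.Walk u v // p.length = i} = (G.natAdjMatrix ^ i) u v := by
  induction i generalizing u with
  | zero =>
    have hs : Subsingleton {p : G.Walk u v // p.length = 0} := by
      constructor
      rintro ⟨p, hp⟩ ⟨q, hq⟩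
      cases p with
      | nil =>
        cases q with
        | nil => rfl
        | cons h q => simp [Walk.length] at hq
      | cons h p => simp [Walk.length] at hp
    refine ⟨inferInstance, ?_⟩
    rw [pow_zero, Matrix.one_apply]
    split_ifs with h
    · subst h
      have : Nonempty {p : G.Walk u u // p.length = 0} := ⟨⟨.nil, rfl⟩⟩
      exact Nat.card_eq_one_iff_unique.2 ⟨hs, this⟩
    · have : IsEmpty {p : G.Walk u v // p.length = 0} :=
        ⟨fun p => h (walk_length_eq_zero p.1 p.2)⟩
      exact Nat.card_of_isEmpty
  | succ i ih =>
    have hf : ∀ x : {x // G.Adj u x}, Finite {p : G.Walk x v // p.length = i} := fun x => (ih x).1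
    refine ⟨Finite.of_equiv _ (walkSuccEquiv G i u v).symm, ?_⟩
    classical
    rw [Nat.card_congr (walkSuccEquiv G i u v), Nat.card_sigma, pow_succ', Matrix.mul_apply]
    simp only [natAdjMatrix, Matrix.of_apply, ite_mul, one_mul, zero_mul]
    rw [← Finset.sum_filter, Finset.sum_subtype (p := fun x => G.Adj u x) _ (by simp)]
    exact Finset.sum_congr rfl fun x _ => (ih x).2

theorem IsGeodetic.sum_pow_natAdjMatrix_le_one {G : Digraph V} {k : ℕ} (h : G.IsGeodetic k)
    (u v : V) : ∑ i ∈ Finset.range (k + 1), (G.natAdjMatrix ^ i) u v ≤ 1 := by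
  have hf : ∀ i : Fin (k + 1), Finite {p : G.Walk u v // p.length = i} :=
    fun i => (finite_walks_and_card G i u v).1
  have hs : Subsingleton (Σ i : Fin (k + 1), {p : G.Walk u v // p.length = i}) := by
    constructor
    rintro ⟨i, p, hp⟩ ⟨j, q, hq⟩
    have hpq := h u v p q (by omega) (by omega)
    subst hpq
    have hij : i = j := Fin.ext (hp.symm.trans hq)
    subst hij
    rfl
  have h1 := Finite.card_le_one_iff_subsingleton.2 hs
  rw [Nat.card_sigma, Fin.sum_univ_eq_sum_range
    (fun i => Nat.card {p : G.Walk u v // p.length = i}) (k + 1)] at h1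
  simpa only [(finite_walks_and_card G _ u v).2] using h1

end AdjacencyMatrix

end Digraph

/-! ### Regularity and the outlier automorphism. -/

namespace Digraph

theorem mooreBound_succ (d k : ℕ) : mooreBound d (k + 1) = 1 + d * mooreBound d k := by
  rw [mooreBound, Finset.sum_range_succ', mooreBound, Finset.mul_sum, pow_zero, add_comm]
  simp only [pow_succ']

section ExcessOneMatrix

variable {V : Type*} [Fintype V] [DecidableEq V]

theorem sum_pow_succ_apply (A : Matrix V V ℕ) (s : Finset V) (i : ℕ) (u : V) :
    ∑ v ∈ s, (A ^ (i + 1)) u v = ∑ x, A u x * ∑ v ∈ s, (A ^ i) x v := by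
  simp only [pow_succ', Matrix.mul_apply, Finset.mul_sum]
  rw [Finset.sum_comm]

/-- The adjacency matrix of a digraph with excess one, up to the value of the minimum out-degree. -/
structure IsExcessOneMatrix (A : Matrix V V ℕ) (d k : ℕ) : Prop where
  geodetic : ∀ u v, ∑ i ∈ Finset.range (k + 1), (A ^ i) u v ≤ 1
  le_degree : ∀ u, d ≤ ∑ v, A u v
  card_eq : Fintype.card V = mooreBound d k + 1

namespace IsExcessOneMatrix

variable {A : Matrix V V ℕ} {d k : ℕ}

theorem pow_apply_le_one (h : IsExcessOneMatrix A d k) {i : ℕ} (hi : i ≤ k) (u v : V) :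
    (A ^ i) u v ≤ 1 :=
  (Finset.single_le_sum (f := fun i => (A ^ i) u v) (fun _ _ => Nat.zero_le _)
    (Finset.mem_range.2 (Nat.lt_succ_of_le hi))).trans (h.geodetic u v)

theorem pow_le_sum_pow (h : IsExcessOneMatrix A d k) (i : ℕ) (u : V) :
    d ^ i ≤ ∑ v, (A ^ i) u v := by
  induction i generalizing u with
  | zero => simp [Matrix.one_apply]
  | succ i ih =>
    rw [sum_pow_succ_apply, pow_succ']
    calc d * d ^ i ≤ (∑ x, A u x) * d ^ i := Nat.mul_le_mul_right _ (h.le_degree u)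
      _ = ∑ x, A u x * d ^ i := Finset.sum_mul _ _ _
      _ ≤ _ := Finset.sum_le_sum fun x _ => Nat.mul_le_mul_left _ (ih x)

/-- A vertex of out-degree at least d + 1 would start at least 1 + (d+1) M(d,k-1) = M(d,k) +
M(d,k-1) walks with distinct ends. This exceeds the order because M(d,k-1) ≥ 2, where k ≥ 2 is used.
-/
theorem sum_eq (h : IsExcessOneMatrix A d k) (hd : 1 ≤ d) (hk : 2 ≤ k) (u : V) :
    ∑ v, A u v = d := by
  refine le_antisymm ?_ (h.le_degree u)
  obtain ⟨m, rfl⟩ : ∃ m, k = m + 2 := ⟨k - 2, by omega⟩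
  have h1 : ∑ v, ∑ i ∈ Finset.range (m + 2 + 1), (A ^ i) u v ≤ Fintype.card V :=
    (Finset.sum_le_sum fun v _ => h.geodetic u v).trans (by simp)
  have h2 : 1 + (∑ v, A u v) * mooreBound d (m + 1) ≤
      ∑ v, ∑ i ∈ Finset.range (m + 2 + 1), (A ^ i) u v := by
    rw [Finset.sum_comm, Finset.sum_range_succ', add_comm]
    refine Nat.add_le_add ?_ (by simp [Matrix.one_apply])
    rw [mooreBound, Finset.mul_sum]
    refine Finset.sum_le_sum fun i _ => ?_
    rw [sum_pow_succ_apply, Finset.sum_mul]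
    exact Finset.sum_le_sum fun x _ => Nat.mul_le_mul_left _ (h.pow_le_sum_pow i x)
  have h3 : 2 ≤ mooreBound d (m + 1) := by
    have h4 : 1 ≤ mooreBound d m := by
      rw [mooreBound, Finset.sum_range_succ', pow_zero]; omega
    rw [mooreBound_succ]
    nlinarith
  rw [h.card_eq, mooreBound_succ] at h1
  by_contra! hlt
  nlinarith [Nat.mul_le_mul_right (mooreBound d (m + 1)) hlt]

theorem sum_pow_eq (h : IsExcessOneMatrix A d k) (hd : 1 ≤ d) (hk : 2 ≤ k) (i : ℕ) (u : V) :
    ∑ v, (A ^ i) u v = d ^ i := by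
  induction i generalizing u with
  | zero => simp [Matrix.one_apply]
  | succ i ih =>
    simp only [sum_pow_succ_apply, ih]
    rw [← Finset.sum_mul, h.sum_eq hd hk, pow_succ']

/-- The row of S has entries at most 1 and total M(d,k), one less than its length, so exactly one
entry vanishes. -/
theorem exists_outlier (h : IsExcessOneMatrix A d k) (hd : 1 ≤ d) (hk : 2 ≤ k) (u : V) :
    ∃ w, ∀ v, ∑ i ∈ Finset.range (k + 1), (A ^ i) u v + (if w = v then 1 else 0) = 1 := by
  have h1 : ∑ v, ∑ i ∈ Finset.range (k + 1), (A ^ i) u v = mooreBound d k := by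
    rw [Finset.sum_comm]
    exact Finset.sum_congr rfl fun i _ => h.sum_pow_eq hd hk i u
  have h2 : ∑ v, (1 - ∑ i ∈ Finset.range (k + 1), (A ^ i) u v) = 1 := by
    have h3 : ∑ v, ((1 - ∑ i ∈ Finset.range (k + 1), (A ^ i) u v) +
        ∑ i ∈ Finset.range (k + 1), (A ^ i) u v) = Fintype.card V := by
      rw [Finset.sum_congr rfl fun v _ => Nat.sub_add_cancel (h.geodetic u v)]
      simp
    rw [Finset.sum_add_distrib, h1, h.card_eq] at h3
    omega
  obtain ⟨w, -, hw⟩ := Finset.exists_ne_zero_of_sum_ne_zero (by rw [h2]; exact one_ne_zero)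
  refine ⟨w, fun v => ?_⟩
  split_ifs with hwv
  · subst hwv; omega
  · have h4 := Finset.add_le_sum (f := fun v => 1 - ∑ i ∈ Finset.range (k + 1), (A ^ i) u v)
      (fun _ _ => Nat.zero_le _) (Finset.mem_univ w) (Finset.mem_univ v) hwv
    have := h.geodetic u v
    omega

theorem pow_apply_self (h : IsExcessOneMatrix A d k) {i : ℕ} (hi : 1 ≤ i) (hik : i ≤ k) (u : V) :
    (A ^ i) u u = 0 := by
  have h1 := Finset.add_le_sum (f := fun i => (A ^ i) u u) (fun _ _ => Nat.zero_le _)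
    (Finset.mem_range.2 (show 0 < k + 1 by omega))
    (Finset.mem_range.2 (show i < k + 1 by omega)) (Nat.ne_of_lt hi)
  have h2 := h.geodetic u u
  simp only [pow_zero, Matrix.one_apply_eq] at h1
  omega

/-- `o` maps every vertex `u` to the unique vertex that no walk of length at most `k` from `u`
reaches. -/
def IsOutlierMap (A : Matrix V V ℕ) (k : ℕ) (o : V → V) : Prop :=
  ∀ u v, ∑ i ∈ Finset.range (k + 1), (A ^ i) u v + (if o u = v then 1 else 0) = 1

theorem exists_isOutlierMap (h : IsExcessOneMatrix A d k) (hd : 1 ≤ d) (hk : 2 ≤ k) :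
    ∃ o : V → V, IsOutlierMap A k o := by
  choose o ho using h.exists_outlier hd hk
  exact ⟨o, ho⟩

variable {o : V → V}

theorem IsOutlierMap.ne_self (ho : IsOutlierMap A k o) (u : V) : o u ≠ u := by
  intro hu
  have h1 := ho u u
  rw [Finset.sum_range_succ', if_pos hu, pow_zero, Matrix.one_apply_eq] at h1
  omega

theorem IsOutlierMap.sum_eq (ho : IsOutlierMap A k o) (s : Finset V) {u : V} (hu : o u ∈ s) :
    ∑ i ∈ Finset.range (k + 1), ∑ v ∈ s, (A ^ i) u v + 1 = s.card := by
  rw [Finset.sum_comm]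
  have h1 := Finset.sum_congr (rfl : s = s) fun v _ => ho u v
  rw [Finset.sum_add_distrib, Finset.sum_ite_eq, if_pos hu] at h1
  simpa using h1

/-- The commutation of the adjacency matrix with the sum of its powers, in terms of the outliers. -/
theorem IsOutlierMap.mul_comm_apply (h : IsExcessOneMatrix A d k) (hd : 1 ≤ d) (hk : 2 ≤ k)
    (ho : IsOutlierMap A k o) (u v : V) :
    (∑ x, A u x * if o x = v then 1 else 0) + ∑ x, A x v = A (o u) v + d := by
  set S : Matrix V V ℕ := ∑ i ∈ Finset.range (k + 1), A ^ i with hS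
  have hSa : ∀ u v, S u v = ∑ i ∈ Finset.range (k + 1), (A ^ i) u v := fun u v => by
    rw [hS, Matrix.sum_apply]
  have hcomm : (A * S) u v = (S * A) u v := by
    rw [hS, Finset.mul_sum, Finset.sum_mul]
    simp only [← pow_succ, ← pow_succ']
  rw [Matrix.mul_apply, Matrix.mul_apply] at hcomm
  have h1 : ∑ x, A u x * S x v + ∑ x, A u x * (if o x = v then 1 else 0) = d := by
    rw [← Finset.sum_add_distrib, ← h.sum_eq hd hk u]
    refine Finset.sum_congr rfl fun x _ => ?_
    rw [← mul_add, hSa, ho x v, mul_one]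
  have h2 : ∑ x, S u x * A x v + A (o u) v = ∑ x, A x v := by
    have h3 : A (o u) v = ∑ x, (if o u = x then 1 else 0) * A x v := by simp
    rw [h3, ← Finset.sum_add_distrib]
    refine Finset.sum_congr rfl fun x _ => ?_
    rw [← add_mul, hSa, ho u x, one_mul]
  omega

/-- A digraph with excess one is diregular. -/
theorem sum_col_eq (h : IsExcessOneMatrix A d k) (hd : 2 ≤ d) (hk : 2 ≤ k) (v : V) :
    ∑ x, A x v = d := by
  obtain ⟨o, ho⟩ := h.exists_isOutlierMap (by omega) hk
  have hc := IsOutlierMap.mul_comm_apply h (by omega) hk ho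
  have hA : ∀ u v, A u v ≤ 1 := fun u v => by
    simpa using h.pow_apply_le_one (i := 1) (by omega) u v
  by_contra hv
  have hsum : ∑ v, ∑ x, A x v = ∑ v : V, d := by
    rw [Finset.sum_comm]
    exact Finset.sum_congr rfl fun x _ => h.sum_eq (by omega) hk x
  obtain ⟨w, hw⟩ : ∃ w, d < ∑ x, A x w := by
    by_contra! hle
    exact hv ((Finset.sum_eq_sum_iff_of_le fun v _ => hle v).1 hsum v (Finset.mem_univ v))
  -- An excess in-degree at `w` forces every outlier to be an in-neighbour of `w`.
  have how : ∀ u, A (o u) w = 1 := fun u => by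
    have := hc u w; have := hA (o u) w; omega
  have hsq : ∀ u x, A u w = 1 → A x w = 1 → A u x = 0 := by
    intro u x hu hx
    by_contra hux
    have h1 := Finset.add_le_sum (f := fun i => (A ^ i) u w) (fun _ _ => Nat.zero_le _)
      (Finset.mem_range.2 (show 1 < k + 1 by omega)) (Finset.mem_range.2 (show 2 < k + 1 by omega))
      (by norm_num)
    have h2 := h.geodetic u w
    have h3 : A u x * A x w ≤ (A ^ 2) u w := by
      rw [pow_two, Matrix.mul_apply]
      exact Finset.single_le_sum (f := fun x => A u x * A x w) (fun _ _ => Nat.zero_le _)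
        (Finset.mem_univ x)
    simp only [pow_one] at h1
    rw [hx] at h3
    omega
  -- If v has in-degree at most d but receives an arc from `o u`, then v is itself an outlier; so `o
  -- u` and v both precede `w`, and the arc between them contradicts `hsq`. Thus row `o u` does not
  -- depend on u.
  have hout : ∀ u v, A (o u) v = if d < ∑ x, A x v then 1 else 0 := by
    intro u v
    have h1 := hc u v
    have h2 := hA (o u) v
    split_ifs with hlt
    · omega
    · by_contra hne
      have h3 : ∑ x, A u x * (if o x = v then 1 else 0) ≠ 0 := by omega
      obtain ⟨x, -, hx⟩ := Finset.exists_ne_zero_of_sum_ne_zero h3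
      have hox : o x = v := by
        by_contra hox
        simp [hox] at hx
      exact hne (hsq (o u) v (how u) (hox ▸ how x))
  set c : V → ℕ := fun v => ∑ x, A x v with hcdef
  let B : Matrix V V ℝ := A.map (Nat.castRingHom ℝ)
  have hBpow : ∀ i u v, (B ^ i) u v = ((A ^ i) u v : ℕ) := fun i u v => by
    have : B ^ i = (A ^ i).map (Nat.castRingHom ℝ) := (Matrix.map_pow A (Nat.castRingHom ℝ) i).symm
    rw [this]; rfl
  have : Nonempty V := ⟨v⟩
  have htr : ∀ i, 1 ≤ i → i ≤ k → (B ^ i).trace = 0 := fun i h1 h2 => by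
    simp [Matrix.trace, hBpow, h.pow_apply_self h1 h2]
  -- every row of `A * ∑ i ≤ k, A ^ i` is the same
  let r : V → ℤ := fun v => c v - (if d < c v then 1 else 0)
  have hrow : ∀ u v, (∑ i ∈ Finset.range (k + 1), ((A ^ (i + 1)) u v : ℤ)) = r v := by
    intro u v
    have h1 : ∑ i ∈ Finset.range (k + 1), (A ^ (i + 1)) u v + A (o u) v = c v := by
      have h3 : A (o u) v = ∑ x, (if o u = x then 1 else 0) * A x v := by simp
      rw [h3]
      simp only [pow_succ, Matrix.mul_apply]
      rw [Finset.sum_comm, ← Finset.sum_add_distrib]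
      refine Finset.sum_congr rfl fun x _ => ?_
      rw [← Finset.sum_mul, ← add_mul, ho u x, one_mul]
    rw [hout] at h1
    have h2 : ((∑ i ∈ Finset.range (k + 1), (A ^ (i + 1)) u v : ℕ) : ℤ)
        + ((if d < c v then 1 else 0 : ℕ) : ℤ) = c v := by exact_mod_cast h1
    push_cast at h2
    simp only [r]
    linarith
  -- Multiplying `hrow` by `A` scales `r` by d; the difference of the two identities leaves only the
  -- end terms.
  have hg : ∀ u v, ((A ^ (k + 2)) u v : ℤ) = A u v + (d - 1) * r v := by
    intro u v
    have h1 : (∑ i ∈ Finset.range (k + 1), ((A ^ (i + 2)) u v : ℤ)) = d * r v := by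
      have : ∀ i, ((A ^ (i + 2)) u v : ℤ) = ∑ x, (A u x : ℤ) * ((A ^ (i + 1)) x v : ℤ) := by
        intro i
        rw [pow_succ' A (i + 1), Matrix.mul_apply]
        push_cast; rfl
      simp only [this]
      rw [Finset.sum_comm]
      simp only [← Finset.mul_sum, hrow]
      rw [← Finset.sum_mul, ← h.sum_eq (by omega) hk u]
      push_cast; rfl
    have h2 := hrow u v
    rw [Finset.sum_range_succ] at h1
    rw [Finset.sum_range_succ'] at h2
    simp only [zero_add, pow_one] at h2
    simp only [add_assoc, one_add_one_eq_two] at h1 h2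
    linarith
  have key := Matrix.pow_eq_of_pow_add_two_sub_const B k d (by exact_mod_cast hd) (by omega)
    (fun u => by
      rw [← h.sum_eq (by omega) hk u]
      push_cast; rfl)
    (fun v => (((d - 1) * r v : ℤ) : ℝ))
    (fun u v => by
      rw [hBpow, show B u v = ((A u v : ℕ) : ℝ) from rfl]
      have := congrArg (Int.cast : ℤ → ℝ) (hg u v)
      simpa using this)
    (by simpa using htr 1 le_rfl (by omega)) (htr k (by omega) le_rfl)
  have hlt : (d : ℝ) ^ 1 < (d : ℝ) ^ k := pow_lt_pow_right₀ (by exact_mod_cast hd) (by omega)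
  rw [key, pow_one] at hlt
  exact lt_irrefl _ hlt

/-- A vertex that is nobody's outlier would be reached from all M(d,k) + 1 vertices, while its
column of S sums to M(d,k). -/
theorem IsOutlierMap.bijective (h : IsExcessOneMatrix A d k) (hd : 2 ≤ d) (hk : 2 ≤ k)
    (ho : IsOutlierMap A k o) : Function.Bijective o := by
  refine Finite.injective_iff_bijective.1 (Finite.injective_iff_surjective.2 fun v => ?_)
  have hcol : ∀ i v, ∑ u, (A ^ i) u v = d ^ i := by
    intro i
    induction i with
    | zero => intro v; simp [Matrix.one_apply]
    | succ i ih =>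
      intro v
      simp only [pow_succ, Matrix.mul_apply]
      rw [Finset.sum_comm]
      simp only [← Finset.sum_mul, ih]
      rw [← Finset.mul_sum, h.sum_col_eq hd hk]
  by_contra! hne
  have h1 := Finset.sum_congr (rfl : (Finset.univ : Finset V) = _) fun u _ => ho u v
  simp only [hne, if_false, add_zero] at h1
  rw [Finset.sum_comm, Finset.sum_congr rfl fun i _ => hcol i v] at h1
  have h2 := h.card_eq
  rw [Finset.sum_const, smul_eq_mul, mul_one, Finset.card_univ, h2, mooreBound] at h1
  exact absurd h1 (Nat.ne_of_lt (Nat.lt_succ_self _))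

theorem IsOutlierMap.apply_apply (h : IsExcessOneMatrix A d k) (hd : 2 ≤ d) (hk : 2 ≤ k)
    (ho : IsOutlierMap A k o) (u v : V) : A (o u) (o v) = A u v := by
  have h1 := IsOutlierMap.mul_comm_apply h (by omega) hk ho u (o v)
  rw [h.sum_col_eq hd hk] at h1
  simp only [(IsOutlierMap.bijective h hd hk ho).1.eq_iff] at h1
  simp at h1
  omega

end IsExcessOneMatrix

end ExcessOneMatrix

end Digraph

/-! ### Cycle lengths of permutations. -/

section PermutationCounting

variable {V : Type*} [DecidableEq V]

/-- If `s` divides the length of every cycle of `σ`, then it divides the number of points. -/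
theorem Equiv.Perm.dvd_card_of_dvd_period [Fintype V] (σ : Equiv.Perm V) (s : ℕ)
    (h : ∀ x m, (σ ^ m) x = x → s ∣ m) : s ∣ Fintype.card V := by
  rcases eq_or_ne s 1 with rfl | hs
  · exact one_dvd _
  have hsupp : σ.support = Finset.univ := by
    refine Finset.eq_univ_iff_forall.2 fun x => Equiv.Perm.mem_support.2 fun hx => hs ?_
    exact Nat.dvd_one.1 (h x 1 (by simpa using hx))
  rw [← Finset.card_univ, ← hsupp, ← Equiv.Perm.sum_cycleType]
  refine Multiset.dvd_sum fun m hm => ?_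
  rw [Equiv.Perm.cycleType_def, Multiset.mem_map] at hm
  obtain ⟨c, hc, rfl⟩ := hm
  have hcyc := (Equiv.Perm.mem_cycleFactorsFinset_iff.1 hc).1
  obtain ⟨x, hx⟩ := hcyc.nonempty_support
  have hcx := Equiv.Perm.cycle_is_cycleOf hx hc
  refine h x _ ?_
  rw [← Equiv.Perm.cycleOf_pow_apply_self, ← hcx, Function.comp_apply, ← hcyc.orderOf,
    pow_orderOf_eq_one, Equiv.Perm.one_apply]

theorem Equiv.Perm.dvd_card_of_dvd_period_on [Fintype V] (σ : Equiv.Perm V) (s : ℕ) (p : V → Prop)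
    [DecidablePred p] (hp : ∀ x, p (σ x) ↔ p x) (h : ∀ x m, p x → (σ ^ m) x = x → s ∣ m) :
    s ∣ (Finset.univ.filter p).card := by
  rw [← Fintype.card_subtype]
  refine Equiv.Perm.dvd_card_of_dvd_period (σ.subtypePerm hp) s fun x m hx => h x m x.2 ?_
  rw [Equiv.Perm.subtypePerm_pow] at hx
  simpa using congrArg Subtype.val hx

theorem Equiv.Perm.pow_two_apply_of_card_eq_two (σ : Equiv.Perm V) (N : Finset V)
    (hN : N.card = 2) (hσ : ∀ x ∈ N, σ x ∈ N) (hne : ∀ x ∈ N, σ x ≠ x) {x : V} (hx : x ∈ N) :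
    (σ ^ 2) x = x := by
  have hsub : ({x, σ x} : Finset V) ⊆ N := by
    intro y hy
    simp only [Finset.mem_insert, Finset.mem_singleton] at hy
    rcases hy with rfl | rfl
    exacts [hx, hσ _ hx]
  have heq := Finset.eq_of_subset_of_card_le hsub
    (by rw [hN, Finset.card_pair (hne x hx).symm])
  have h2 := hσ _ (hσ x hx)
  rw [← heq] at h2
  simp only [Finset.mem_insert, Finset.mem_singleton] at h2
  exact h2.resolve_right (hne _ (hσ x hx))

theorem Equiv.Perm.pow_three_apply_of_card_eq_three (σ : Equiv.Perm V) (N : Finset V)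
    (hN : N.card = 3) (hσ : ∀ x ∈ N, σ x ∈ N) (hne : ∀ x ∈ N, σ x ≠ x) {x : V} (hx : x ∈ N) :
    (σ ^ 3) x = x := by
  have h1 := hσ x hx
  have h2 := hσ _ h1
  have h3 := hσ _ h2
  change σ (σ (σ x)) = x
  by_cases hxx : σ (σ x) = x
  · exfalso
    obtain ⟨y, hy, hyn⟩ := Finset.exists_mem_notMem_of_card_lt_card (s := {x, σ x}) (t := N)
      (by rw [hN, Finset.card_pair (hne x hx).symm]; norm_num)
    simp only [Finset.mem_insert, Finset.mem_singleton, not_or] at hyn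
    have hsub : ({y, x, σ x} : Finset V) ⊆ N := by
      intro z hz
      simp only [Finset.mem_insert, Finset.mem_singleton] at hz
      rcases hz with rfl | rfl | rfl <;> assumption
    have heq := Finset.eq_of_subset_of_card_le hsub (by
      rw [hN, Finset.card_insert_of_notMem (by simp [hyn]), Finset.card_pair (hne x hx).symm])
    have h4 := hσ y hy
    rw [← heq] at h4
    simp only [Finset.mem_insert, Finset.mem_singleton] at h4
    rcases h4 with h4 | h4 | h4
    · exact hne y hy h4
    · exact hyn.2 (σ.injective (h4.trans hxx.symm))
    · exact hyn.1 (σ.injective h4)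
  · have hsub : ({x, σ x, σ (σ x)} : Finset V) ⊆ N := by
      intro z hz
      simp only [Finset.mem_insert, Finset.mem_singleton] at hz
      rcases hz with rfl | rfl | rfl <;> assumption
    have heq := Finset.eq_of_subset_of_card_le hsub (by
      rw [hN, Finset.card_insert_of_notMem (by simp [(hne x hx).symm, Ne.symm hxx]),
        Finset.card_pair (hne _ h1).symm])
    rw [← heq] at h3
    simp only [Finset.mem_insert, Finset.mem_singleton] at h3
    rcases h3 with h3 | h3 | h3
    · exact h3
    · exact absurd (σ.injective h3) hxx
    · exact absurd h3 (hne _ h2)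

end PermutationCounting

/-! ### Fixed vertices of automorphisms. -/

namespace Digraph

namespace IsExcessOneMatrix

section FixedPoints

theorem perm_pow_apply {V : Type*} {A : Matrix V V ℕ} {σ : Equiv.Perm V}
    (hσ : ∀ u v, A (σ u) (σ v) = A u v) (m : ℕ) (u v : V) :
    A ((σ ^ m) u) ((σ ^ m) v) = A u v := by
  induction m with
  | zero => rfl
  | succ m ih => rw [pow_succ', Equiv.Perm.mul_apply, Equiv.Perm.mul_apply, hσ, ih]

variable {V : Type*} [Fintype V] [DecidableEq V] {A : Matrix V V ℕ} {d k : ℕ} {o : V → V}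
  {σ : Equiv.Perm V}

/-- The set of vertices fixed by a permutation. -/
def fixedVertices (σ : Equiv.Perm V) : Finset V :=
  Finset.univ.filter fun x => σ x = x

theorem mem_fixedVertices {x : V} : x ∈ fixedVertices σ ↔ σ x = x := by
  simp [fixedVertices]

/-- The out-neighbours of `u` that are moved by a permutation. -/
def movedNeighbours (A : Matrix V V ℕ) (σ : Equiv.Perm V) (u : V) : Finset V :=
  Finset.univ.filter fun x => A u x = 1 ∧ σ x ≠ x

theorem mem_movedNeighbours {u x : V} :
    x ∈ movedNeighbours A σ u ↔ A u x = 1 ∧ σ x ≠ x := by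
  simp [movedNeighbours]

theorem apply_le_one (h : IsExcessOneMatrix A d k) (hk : 1 ≤ k) (u v : V) : A u v ≤ 1 := by
  simpa using h.pow_apply_le_one (i := 1) hk u v

theorem pow_apply_perm (hσ : ∀ u v, A (σ u) (σ v) = A u v) (i : ℕ) (u v : V) :
    (A ^ i) (σ u) (σ v) = (A ^ i) u v := by
  induction i generalizing u with
  | zero => simp [Matrix.one_apply]
  | succ i ih =>
    rw [pow_succ', Matrix.mul_apply, Matrix.mul_apply, ← Equiv.sum_comp σ]
    simp only [hσ, ih]

theorem perm_mem_movedNeighbours (hσ : ∀ u v, A (σ u) (σ v) = A u v) {u x : V} (hu : σ u = u)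
    (hx : x ∈ movedNeighbours A σ u) : σ x ∈ movedNeighbours A σ u := by
  rw [mem_movedNeighbours] at hx ⊢
  refine ⟨?_, fun h => hx.2 (σ.injective h)⟩
  rw [← hx.1, ← hσ u x, hu]

theorem card_movedNeighbours_add (h : IsExcessOneMatrix A d k) (hd : 1 ≤ d) (hk : 2 ≤ k) (u : V) :
    (movedNeighbours A σ u).card + ∑ x ∈ fixedVertices σ, A u x = d := by
  rw [← h.sum_eq hd hk u, ← Finset.sum_filter_not_add_sum_filter Finset.univ (fun x => σ x = x),
    fixedVertices]
  congr 1
  rw [movedNeighbours, Finset.card_eq_sum_ones, Finset.sum_filter, Finset.sum_filter]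
  refine Finset.sum_congr rfl fun x _ => ?_
  have := h.apply_le_one (by omega) u x
  interval_cases A u x <;> simp

/-- Every walk of length at most `k` between two fixed vertices passes through fixed vertices
only. -/
theorem sum_pow_succ_fixedVertices (h : IsExcessOneMatrix A d k)
    (hσ : ∀ u v, A (σ u) (σ v) = A u v) {i : ℕ} (hi : i + 1 ≤ k) {u : V}
    (hu : σ u = u) :
    ∑ v ∈ fixedVertices σ, (A ^ (i + 1)) u v =
      ∑ x ∈ fixedVertices σ, A u x * ∑ v ∈ fixedVertices σ, (A ^ i) x v := by
  rw [sum_pow_succ_apply]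
  symm
  refine Finset.sum_subset (Finset.subset_univ _) fun x _ hx => ?_
  rw [mem_fixedVertices] at hx
  rw [Finset.mul_sum]
  refine Finset.sum_eq_zero fun v hv => ?_
  rw [mem_fixedVertices] at hv
  -- A walk through a moved `x` and its image through `σ x` would be two walks of equal length
  -- between the same ends.
  have h1 : A u (σ x) * (A ^ i) (σ x) v = A u x * (A ^ i) x v := by
    conv_lhs => rw [← hu, ← hv]
    rw [hσ, pow_apply_perm hσ]
  have h2 := Finset.add_le_sum (f := fun x => A u x * (A ^ i) x v) (fun _ _ => Nat.zero_le _)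
    (Finset.mem_univ (σ x)) (Finset.mem_univ x) hx
  have h3 := h.pow_apply_le_one hi u v
  rw [pow_succ', Matrix.mul_apply] at h3
  simp only [h1] at h2
  omega

/-- A single moved out-neighbour would have to be mapped to itself. -/
theorem sum_fixedVertices_ne_two (h : IsExcessOneMatrix A 3 k) (hk : 2 ≤ k)
    (hσ : ∀ u v, A (σ u) (σ v) = A u v) {u : V} (hu : σ u = u) :
    ∑ x ∈ fixedVertices σ, A u x ≠ 2 := by
  intro h2
  have h1 := h.card_movedNeighbours_add (σ := σ) (by norm_num) hk u
  obtain ⟨x, hx⟩ := Finset.card_eq_one.1 (show (movedNeighbours A σ u).card = 1 by omega)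
  have hxm : x ∈ movedNeighbours A σ u := by simp [hx]
  have hsx := perm_mem_movedNeighbours hσ hu hxm
  rw [hx, Finset.mem_singleton] at hsx
  exact (mem_movedNeighbours.1 hxm).2 hsx

/-- An automorphism of a digraph with degree three and excess one that commutes with the outlier
map and fixes a vertex fixes either two vertices, or the `k + 2` vertices of a directed cycle, or
everything. -/
theorem fixedVertices_trichotomy (h : IsExcessOneMatrix A 3 k) (hk : 2 ≤ k)
    (ho : IsOutlierMap A k o) (hσ : ∀ u v, A (σ u) (σ v) = A u v) (hσo : ∀ u, σ (o u) = o (σ u))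
    {u₀ : V} (hu₀ : σ u₀ = u₀) :
    ((fixedVertices σ).card = 2 ∧ ∃ u, σ u = u ∧ ∑ x ∈ fixedVertices σ, A u x = 0) ∨
    ((fixedVertices σ).card = k + 2 ∧ ∀ u, σ u = u → ∑ x ∈ fixedVertices σ, A u x = 1) ∨
    ∀ x, σ x = x := by
  set F := fixedVertices σ with hF
  -- `l i u` counts the walks of length i from `u` that end in `F`. The outlier of a fixed vertex is
  -- fixed, so these counts sum to |F| - 1.
  set l : ℕ → V → ℕ := fun i u => ∑ v ∈ F, (A ^ i) u v with hl
  have hcard : ∀ u, σ u = u → ∑ i ∈ Finset.range (k + 1), l i u + 1 = F.card := fun u hu =>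
    ho.sum_eq F (by rw [hF, mem_fixedVertices, hσo, hu])
  have hl0 : ∀ u, σ u = u → l 0 u = 1 := fun u hu => by
    have : u ∈ F := mem_fixedVertices.2 hu
    simp [hl, Matrix.one_apply, this]
  have hrec : ∀ i u, i + 1 ≤ k → σ u = u → l (i + 1) u = ∑ x ∈ F, A u x * l i x :=
    fun i u hi hu => h.sum_pow_succ_fixedVertices hσ hi hu
  have hl1 : ∀ u, l 1 u = ∑ x ∈ F, A u x := fun u => by simp [hl]
  have hdeg : ∀ u, σ u = u → l 1 u ≤ 3 ∧ l 1 u ≠ 2 := fun u hu => by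
    have h1 := h.card_movedNeighbours_add (σ := σ) (by norm_num) hk u
    have h2 := h.sum_fixedVertices_ne_two hk hσ hu
    rw [← hF] at h1 h2
    rw [hl1]
    exact ⟨by omega, h2⟩
  simp only [← hl1]
  by_cases hzero : ∃ u, σ u = u ∧ l 1 u = 0
  · left
    refine ⟨?_, hzero⟩
    obtain ⟨u, hu, hu1⟩ := hzero
    rw [← hcard u hu, Finset.sum_range_succ', hl0 u hu, Finset.sum_eq_zero]
    intro i hi
    rw [hrec i u (by simpa using hi) hu]
    rw [hl1, Finset.sum_eq_zero_iff] at hu1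
    exact Finset.sum_eq_zero fun x hx => by rw [hu1 x hx, zero_mul]
  right
  have hpos : ∀ u, σ u = u → 1 ≤ l 1 u := fun u hu => by
    by_contra hlt
    exact hzero ⟨u, hu, by omega⟩
  have hmono : ∀ i u, i + 1 ≤ k → σ u = u → l i u ≤ l (i + 1) u := by
    intro i
    induction i with
    | zero => intro u _ hu; rw [hl0 u hu]; exact hpos u hu
    | succ i ih =>
      intro u hi hu
      rw [hrec i u (by omega) hu, hrec (i + 1) u hi hu]
      exact Finset.sum_le_sum fun x hx =>
        Nat.mul_le_mul_left _ (ih x (by omega) (mem_fixedVertices.1 hx))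
  have hmono' : ∀ i j u, i ≤ j → j ≤ k → σ u = u → l i u ≤ l j u := by
    intro i j u hij
    induction j, hij using Nat.le_induction with
    | base => intro _ _; exact le_rfl
    | succ j _ ih => intro hj hu; exact (ih (by omega) hu).trans (hmono j u hj hu)
  by_cases hone : ∃ u, σ u = u ∧ l 1 u = 1
  · left
    obtain ⟨u, hu, hu1⟩ := hone
    obtain ⟨v, hv, hlv⟩ : ∃ v, σ v = v ∧ ∀ i, i + 1 ≤ k → l (i + 1) u = l i v := by
      rw [hl1] at hu1
      obtain ⟨v, hv, hne⟩ := Finset.exists_ne_zero_of_sum_ne_zero (by rw [hu1]; exact one_ne_zero)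
      have hle := Finset.sum_erase_add F (fun x => A u x) hv
      have hz : ∑ x ∈ F.erase v, A u x = 0 := by omega
      refine ⟨v, mem_fixedVertices.1 hv, fun i hi => ?_⟩
      rw [hrec i u hi hu, ← Finset.sum_erase_add F _ hv]
      rw [hz, zero_add, hu1] at hle
      rw [hle, one_mul, Finset.sum_eq_zero, zero_add]
      intro x hx
      rw [Finset.sum_eq_zero_iff.1 hz x hx, zero_mul]
    have h1 := hcard u hu
    have h2 := hcard v hv
    rw [Finset.sum_range_succ', hl0 u hu,
      Finset.sum_congr rfl fun i hi => hlv i (by simpa using hi)] at h1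
    -- The counts for `u` are those for its only fixed out-neighbour `v`, shifted by one step;
    -- equality of the totals leaves l_k(v) = 1, and monotonicity makes every l_i(v) equal to 1.
    have h3 : l k v = 1 := by rw [Finset.sum_range_succ] at h2; omega
    have h4 : ∀ i ∈ Finset.range (k + 1), l i v = 1 := by
      intro i hi
      have hik : i ≤ k := by simpa [Nat.lt_succ_iff] using hi
      have h5 := hmono' i k v hik le_rfl hv
      have h6 := hmono' 0 i v (Nat.zero_le _) hik hv
      rw [hl0 v hv] at h6
      omega
    rw [Finset.sum_congr rfl h4] at h2
    simp only [Finset.sum_const, Finset.card_range, smul_eq_mul, mul_one] at h2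
    refine ⟨h2.symm, fun w hw => ?_⟩
    by_contra hw1
    -- Degree three would give |F| ≥ 3k + 2 > k + 2.
    have hw3 : l 1 w = 3 := by have := hdeg w hw; have := hpos w hw; omega
    have h7 := hcard w hw
    have h8 : ∑ _i ∈ Finset.range k, 3 ≤ ∑ i ∈ Finset.range k, l (i + 1) w := by
      refine Finset.sum_le_sum fun i hi => ?_
      rw [← hw3]
      exact hmono' 1 (i + 1) w (by omega) (by simpa using hi) hw
    rw [Finset.sum_range_succ'] at h7
    simp only [Finset.sum_const, Finset.card_range, smul_eq_mul] at h8
    omega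
  · right
    have hthree : ∀ u, σ u = u → l 1 u = 3 := fun u hu => by
      have h1 : l 1 u ≠ 1 := fun h1 => hone ⟨u, hu, h1⟩
      have := hdeg u hu; have := hpos u hu; omega
    have hpow : ∀ i, i ≤ k → ∀ u, σ u = u → l i u = 3 ^ i := by
      intro i
      induction i with
      | zero => intro _ u hu; rw [hl0 u hu, pow_zero]
      | succ i ih =>
        intro hi u hu
        rw [hrec i u hi hu, Finset.sum_congr rfl fun x hx => by
          rw [ih (by omega) x (mem_fixedVertices.1 hx)], ← Finset.sum_mul, ← hl1, hthree u hu,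
          pow_succ']
    have h1 := hcard u₀ hu₀
    rw [Finset.sum_congr rfl fun i hi => hpow i (by simpa [Nat.lt_succ_iff] using hi) u₀ hu₀] at h1
    have h2 : F = Finset.univ := by
      rw [← Finset.card_eq_iff_eq_univ, h.card_eq, ← h1, mooreBound]
    intro x
    rw [← mem_fixedVertices, ← hF, h2]
    exact Finset.mem_univ x

end FixedPoints

end IsExcessOneMatrix

end Digraph

/-! ### Nonexistence for prime order. -/

namespace Digraph

namespace IsExcessOneMatrix

section NonExistence

theorem exists_pow_apply_of_card_le {V : Type*} [Fintype V] {o : Equiv.Perm V} (u : V)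
    (hmin : ∀ m, 1 ≤ m → m < Fintype.card V → (o ^ m) u ≠ u) (x : V) : ∃ i : ℕ, (o ^ i) u = x := by
  have hne : ∀ i j : Fin (Fintype.card V), i < j → (o ^ (i : ℕ)) u ≠ (o ^ (j : ℕ)) u := by
    intro i j hij heq
    have hij' : (i : ℕ) < j := hij
    refine hmin (j - i) (by omega) (by omega) ((o ^ (i : ℕ)).injective ?_)
    rw [← Equiv.Perm.mul_apply, ← pow_add, Nat.add_sub_cancel' hij'.le, heq]
  have hinj : Function.Injective fun i : Fin (Fintype.card V) => (o ^ (i : ℕ)) u := by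
    intro i j hij
    rcases lt_trichotomy i j with hlt | rfl | hlt
    · exact absurd hij (hne i j hlt)
    · rfl
    · exact absurd hij.symm (hne j i hlt)
  obtain ⟨i, hi⟩ := ((Fintype.bijective_iff_injective_and_card _).2 ⟨hinj, by simp⟩).2 x
  exact ⟨i, hi⟩

theorem pow_mod_apply {V : Type*} {o : Equiv.Perm V} {n m : ℕ} {x : V} (hn : o ^ n = 1)
    (hx : (o ^ m) x = x) :
    (o ^ (m % n)) x = x := by
  rwa [← Nat.mod_add_div m n, pow_add, pow_mul, hn, one_pow, mul_one] at hx

variable {V : Type*} [Fintype V] [DecidableEq V] {A : Matrix V V ℕ} {k : ℕ} {o σ : Equiv.Perm V}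

/-- If a power of an automorphism fixing `u` fixes all out-neighbours of `u` that the automorphism
moves, and the automorphism is not trivial at `u`, then this power is the identity. -/
theorem pow_eq_one_of_movedNeighbours (h : IsExcessOneMatrix A 3 k) (hk : 2 ≤ k)
    (ho : IsOutlierMap A k o) (hσ : ∀ u v, A (σ u) (σ v) = A u v) (hσo : Commute σ o) {u : V}
    (hu : σ u = u) (m : ℕ) (hm : ∀ x ∈ movedNeighbours A σ u, (σ ^ m) x = x)
    (hne : (movedNeighbours A σ u).Nonempty) (hcard : 2 ≤ (fixedVertices σ).card) :
    σ ^ m = 1 := by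
  have hfix : ∀ x, σ x = x → (σ ^ m) x = x := fun x hx => by
    rw [Equiv.Perm.pow_apply_eq_self_of_apply_eq_self hx]
  have hN : movedNeighbours A (σ ^ m) u = ∅ := by
    refine Finset.eq_empty_of_forall_notMem fun x hx => ?_
    rw [mem_movedNeighbours] at hx
    by_cases hxs : σ x = x
    · exact hx.2 (hfix x hxs)
    · exact hx.2 (hm x (mem_movedNeighbours.2 ⟨hx.1, hxs⟩))
  have hsum := h.card_movedNeighbours_add (σ := σ ^ m) (by norm_num) hk u
  rw [hN, Finset.card_empty, zero_add] at hsum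
  -- The fixed set grows strictly beyond two vertices, and `u` has three fixed out-neighbours; only
  -- the last case of the trichotomy remains.
  have hlt : (fixedVertices σ).card < (fixedVertices (σ ^ m)).card := by
    refine Finset.card_lt_card (Finset.ssubset_iff_subset_ne.2 ⟨fun x hx => ?_, fun heq => ?_⟩)
    · exact mem_fixedVertices.2 (hfix x (mem_fixedVertices.1 hx))
    · obtain ⟨x, hx⟩ := hne
      have hxm := mem_fixedVertices.2 (hm x hx)
      rw [← heq, mem_fixedVertices] at hxm
      exact (mem_movedNeighbours.1 hx).2 hxm
  have hcomm := hσo.pow_left m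
  rcases h.fixedVertices_trichotomy hk ho (perm_pow_apply hσ m)
    (fun v => by simpa using congrArg (· v) hcomm.eq) (hfix u hu) with h1 | h1 | h1
  · omega
  · have := h1.2 u (hfix u hu)
    omega
  · exact Equiv.ext h1

/-- `o` preserves the fixed set of its power and has no fixed point, so it swaps the two vertices.
-/
theorem pow_two_apply_of_card_fixedVertices (ho : IsOutlierMap A k o) {m : ℕ} {x : V}
    (hx : (o ^ m) x = x) (hcard : (fixedVertices (o ^ m)).card = 2) : (o ^ 2) x = x := by
  have hmap : ∀ y, (o ^ m) y = y → (o ^ m) (o y) = o y := fun y hy => by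
    rw [← Equiv.Perm.mul_apply, ← pow_succ, pow_succ', Equiv.Perm.mul_apply, hy]
  exact o.pow_two_apply_of_card_eq_two _ hcard
    (fun y hy => mem_fixedVertices.2 (hmap y (mem_fixedVertices.1 hy)))
    (fun y _ => ho.ne_self y) (mem_fixedVertices.2 hx)

/-- No automorphism of a digraph with excess one permutes the vertices in a single cycle: walks of
length two would commute. -/
theorem not_exists_pow_apply (h : IsExcessOneMatrix A 3 k) (hk : 2 ≤ k)
    (hσ : ∀ u v, A (σ u) (σ v) = A u v) (u : V) : ¬ ∀ x, ∃ i : ℕ, (σ ^ i) u = x := by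
  intro htr
  have h2 : 1 < (Finset.univ.filter fun x => A u x = 1).card := by
    have h3 : ∑ x, A u x = (Finset.univ.filter fun x => A u x = 1).card := by
      rw [Finset.card_eq_sum_ones, Finset.sum_filter]
      refine Finset.sum_congr rfl fun x _ => ?_
      have := h.apply_le_one (by omega) u x
      interval_cases A u x <;> simp
    rw [← h3, h.sum_eq (by norm_num) hk]
    norm_num
  obtain ⟨x, hx, y, hy, hxy⟩ := Finset.one_lt_card.1 h2
  simp only [Finset.mem_filter, Finset.mem_univ, true_and] at hx hy
  obtain ⟨a, rfl⟩ := htr x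
  obtain ⟨b, rfl⟩ := htr y
  have hxz : A ((σ ^ a) u) ((σ ^ (a + b)) u) = 1 := by
    rw [pow_add, Equiv.Perm.mul_apply, perm_pow_apply hσ, hy]
  have hyz : A ((σ ^ b) u) ((σ ^ (a + b)) u) = 1 := by
    rw [add_comm, pow_add, Equiv.Perm.mul_apply, perm_pow_apply hσ, hx]
  have h4 := Finset.add_le_sum (f := fun x => A u x * A x ((σ ^ (a + b)) u))
    (fun _ _ => Nat.zero_le _) (Finset.mem_univ _) (Finset.mem_univ _) hxy
  have h5 := h.pow_apply_le_one hk u ((σ ^ (a + b)) u)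
  rw [pow_two, Matrix.mul_apply] at h5
  simp only [hx, hy, hxz, hyz] at h4
  omega

theorem false_of_prime (h : IsExcessOneMatrix A 3 k) (hk : 2 ≤ k) (hk3 : ¬ 3 ∣ k + 2)
    (hp : (Fintype.card V).Prime) : False := by
  obtain ⟨f, hf⟩ := h.exists_isOutlierMap (by norm_num) hk
  obtain ⟨o, rfl⟩ : ∃ o : Equiv.Perm V, f = o :=
    ⟨Equiv.ofBijective f (hf.bijective h (by norm_num) hk), rfl⟩
  have hA : ∀ u v, A (o u) (o v) = A u v := hf.apply_apply h (by norm_num) hk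
  have hne := hf.ne_self
  have htri : ∀ m {x : V}, (o ^ m) x = x → _ := fun m x hx =>
    h.fixedVertices_trichotomy hk hf (perm_pow_apply hA m)
      (fun v => by simpa using congrArg (· v) ((Commute.refl o).pow_left m).eq) hx
  obtain ⟨u₀⟩ : Nonempty V := Fintype.card_pos_iff.1 hp.pos
  classical
  have hex : ∃ s, 1 ≤ s ∧ ∃ u, (o ^ s) u = u :=
    ⟨orderOf o, orderOf_pos o, u₀, by rw [pow_orderOf_eq_one]; rfl⟩
  obtain ⟨hs1, v, hv⟩ := Nat.find_spec hex
  have hmin : ∀ m, 1 ≤ m → m < Nat.find hex → ∀ x, (o ^ m) x ≠ x := fun m hm hlt x hx =>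
    Nat.find_min hex hlt ⟨hm, x, hx⟩
  generalize Nat.find hex = s at hs1 hv hmin
  have hs2 : s ≠ 1 := by
    rintro rfl
    exact hne v (by simpa using hv)
  have hdvd : ¬ s ∣ Fintype.card V := by
    intro hdvd
    have hs := ((Nat.dvd_prime hp).1 hdvd).resolve_left hs2
    exact h.not_exists_pow_apply hk hA v
      (exists_pow_apply_of_card_le v fun m h1 h2 => hmin m h1 (hs ▸ h2) v)
  have hcomm : ∀ m, Commute (o ^ m) o := fun m => (Commute.refl o).pow_left m
  rcases htri s hv with ⟨hcard, u, hu, hu0⟩ | ⟨hcard, hone⟩ | hid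
  · have hv2 := pow_two_apply_of_card_fixedVertices hf hv hcard
    obtain rfl : s = 2 := by
      by_contra hne2
      exact hmin 2 (by norm_num) (by omega) v hv2
    have hN := h.card_movedNeighbours_add (σ := o ^ 2) (by norm_num) hk u
    rw [hu0, add_zero] at hN
    -- `o ^ 2` permutes the three out-neighbours of `u` without fixed points, hence as a 3-cycle.
    have h6 : o ^ 6 = 1 := by
      have h1 := h.pow_eq_one_of_movedNeighbours hk hf (perm_pow_apply hA 2) (hcomm 2) hu 3
        (fun x hx => (o ^ 2).pow_three_apply_of_card_eq_three _ hN
          (fun y hy => perm_mem_movedNeighbours (perm_pow_apply hA 2) hu hy)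
          (fun y hy => (mem_movedNeighbours.1 hy).2) hx)
        (Finset.card_pos.1 (by omega)) hcard.ge
      rwa [← pow_mul] at h1
    -- If `o ^ 3` had k + 2 fixed vertices, `o` would split them into 3-cycles, against 3 ∤ k + 2.
    -- Without fixed points of `o ^ 3`, all cycles of `o` are even.
    have hodd : ∀ x, (o ^ 3) x ≠ x := by
      intro x hx
      have hnot2 : ∀ y, (o ^ 3) y = y → (o ^ 2) y ≠ y := fun y h3 h2 => by
        rw [pow_succ', Equiv.Perm.mul_apply, h2] at h3
        exact hne y h3
      rcases htri 3 hx with ⟨hc, -⟩ | ⟨hc, -⟩ | hid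
      · exact hnot2 x hx (pow_two_apply_of_card_fixedVertices hf hx hc)
      · refine hk3 (hc ▸ o.dvd_card_of_dvd_period_on 3 (fun y => (o ^ 3) y = y) (fun y => ?_) ?_)
        · rw [← Equiv.Perm.mul_apply, ← pow_succ, pow_succ', Equiv.Perm.mul_apply,
            o.injective.eq_iff]
        · intro y m hy hm
          have hm3 : (o ^ (m % 3)) y = y := by
            rw [← Nat.mod_add_div m 3, pow_add, pow_mul, Equiv.Perm.mul_apply,
              Equiv.Perm.pow_apply_eq_self_of_apply_eq_self hy] at hm
            exact hm
          by_contra hmod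
          have : m % 3 = 1 ∨ m % 3 = 2 := by omega
          rcases this with h1 | h1 <;> rw [h1] at hm3
          · exact hne y (by simpa using hm3)
          · exact hnot2 y hy hm3
      · exact hnot2 v (hid v) hv2
    refine hdvd (o.dvd_card_of_dvd_period 2 fun x m hm => ?_)
    have ht := pow_mod_apply h6 hm
    by_contra hmod
    have : m % 6 = 1 ∨ m % 6 = 3 ∨ m % 6 = 5 := by omega
    rcases this with h1 | h1 | h1 <;> rw [h1] at ht
    · exact hne x (by simpa using ht)
    · exact hodd x ht
    · have hx6 : (o ^ 6) x = x := by rw [h6]; rfl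
      rw [pow_succ', Equiv.Perm.mul_apply, ht] at hx6
      exact hne x hx6
  · have hN := h.card_movedNeighbours_add (σ := o ^ s) (by norm_num) hk v
    rw [hone v hv] at hN
    have hN2 : (movedNeighbours A (o ^ s) v).card = 2 := by omega
    have h2s : o ^ (s * 2) = 1 := by
      rw [pow_mul]
      exact h.pow_eq_one_of_movedNeighbours hk hf (perm_pow_apply hA s) (hcomm s) hv 2
        (fun x hx => (o ^ s).pow_two_apply_of_card_eq_two _ hN2
          (fun y hy => perm_mem_movedNeighbours (perm_pow_apply hA s) hv hy)
          (fun y hy => (mem_movedNeighbours.1 hy).2) hx)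
        (Finset.card_pos.1 (by omega)) (by omega)
    refine hdvd (o.dvd_card_of_dvd_period s fun x m hm => ?_)
    have ht := pow_mod_apply h2s hm
    have hlt : m % (s * 2) < s * 2 := Nat.mod_lt _ (by omega)
    -- If 0 < t < 2s and `o ^ t` fixes `x`, so does `o ^ (2s - t)`; minimality of s bounds both
    -- exponents below by s, so t = s.
    have hms : s ∣ m % (s * 2) := by
      generalize m % (s * 2) = t at ht hlt
      rcases Nat.eq_zero_or_pos t with rfl | hpos
      · exact dvd_zero s
      have hst : s ≤ t := by
        by_contra! hts
        exact hmin t hpos hts x ht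
      have hrev : (o ^ (s * 2 - t)) x = x := by
        have h1 : (o ^ (s * 2 - t + t)) x = x := by
          rw [Nat.sub_add_cancel hlt.le, h2s]; rfl
        rwa [pow_add, Equiv.Perm.mul_apply, ht] at h1
      have hle : s ≤ s * 2 - t := by
        by_contra! hts
        exact hmin _ (by omega) hts x hrev
      have : t = s := by omega
      rw [this]
    exact (Nat.dvd_mod_iff (Dvd.intro 2 rfl)).1 hms
  · refine hdvd (o.dvd_card_of_dvd_period s fun x m hm => ?_)
    have ht := pow_mod_apply (Equiv.ext hid) hm
    by_contra hmod
    exact hmin _ (Nat.pos_of_ne_zero fun h0 => hmod (Nat.dvd_of_mod_eq_zero h0))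
      (Nat.mod_lt _ hs1) x ht

end NonExistence

end IsExcessOneMatrix

theorem IsExcessOne.isExcessOneMatrix {V : Type*} [Fintype V] [DecidableEq V] {G : Digraph V}
    {d k : ℕ} (h : G.IsExcessOne d k) : IsExcessOneMatrix G.natAdjMatrix d k where
  geodetic := h.geodetic.sum_pow_natAdjMatrix_le_one
  le_degree u := by
    rw [sum_natAdjMatrix_eq_outDegree]
    exact h.minOutDegree.2 ⟨u, rfl⟩
  card_eq := by rw [← Nat.card_eq_fintype_card, h.order]

theorem not_isExcessOne_three {k : ℕ} (hk : 2 ≤ k) (hk3 : ¬ 3 ∣ k + 2)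
    (hp : (mooreBound 3 k + 1).Prime) {V : Type*} (G : Digraph V) : ¬ G.IsExcessOne 3 k := by
  intro h
  classical
  have := h.finite
  have := Fintype.ofFinite V
  have hA := h.isExcessOneMatrix
  exact hA.false_of_prime hk hk3 (hA.card_eq ▸ hp)

theorem mooreBound_three (k : ℕ) : mooreBound 3 k = (3 ^ (k + 1) - 1) / 2 := by
  rw [mooreBound, Nat.geomSum_eq (by norm_num)]

theorem prime_mooreBound_three_three : (mooreBound 3 3 + 1).Prime := by
  norm_num [mooreBound_three]

theorem prime_mooreBound_three_fifteen : (mooreBound 3 15 + 1).Prime := by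
  norm_num [mooreBound_three]

/-- A form of `lucas_primality` in which the prime factors of `p - 1` are given as a list. -/
theorem _root_.Nat.prime_of_forall_mem_pow_ne_one {p : ℕ} (a : ZMod p) (l : List ℕ)
    (hl : ∀ f ∈ l, f.Prime) (hprod : l.prod = p - 1) (h1 : a ^ (p - 1) = 1)
    (h2 : ∀ f ∈ l, a ^ ((p - 1) / f) ≠ 1) : p.Prime := by
  refine lucas_primality p a h1 fun q hq hqp => ?_
  rw [← hprod, hq.prime.dvd_prod_iff] at hqp
  obtain ⟨f, hf, hqf⟩ := hqp
  rw [(Nat.prime_dvd_prime_iff_eq hq (hl f hf)).1 hqf]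
  exact h2 f hf

/-- The prime is (3^64 + 1)/2, and p - 1 = (3^64 - 1)/2 factors by repeated difference of squares.
The large factors are (3^16 + 1)/2 = 21523361 and (3^32 + 1)/2 = 926510094425921, the latter
certified in the same way. -/
theorem prime_mooreBound_three_sixtyThree : (mooreBound 3 63 + 1).Prime := by
  have h : Nat.Prime 926510094425921 := by
    refine Nat.prime_of_forall_mem_pow_ne_one 7 [2, 2, 2, 2, 2, 2, 5, 17, 41, 193, 21523361]
      (by simp only [List.forall_mem_cons]; norm_num) (by norm_num)
      (by simp only [Nat.reduceSub]; reduce_mod_char) ?_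
    simp only [List.forall_mem_cons, Nat.reduceSub, Nat.reduceDiv]
    reduce_mod_char
    exact ⟨by decide, by decide, by decide, by decide, by decide, by decide, by decide, by decide,
      by decide, by decide, by decide, by simp⟩
  rw [mooreBound_three,
    show (3 ^ (63 + 1) - 1) / 2 + 1 = 1716841910146256242328924544641 by norm_num]
  refine Nat.prime_of_forall_mem_pow_ne_one 6
    [2, 2, 2, 2, 2, 2, 2, 5, 17, 41, 193, 21523361, 926510094425921]
    (by simp only [List.forall_mem_cons, h, true_and]; norm_num) (by norm_num)
    (by simp only [Nat.reduceSub]; reduce_mod_char) ?_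
  simp only [List.forall_mem_cons, Nat.reduceSub, Nat.reduceDiv]
  reduce_mod_char
  exact ⟨by decide, by decide, by decide, by decide, by decide, by decide, by decide, by decide,
    by decide, by decide, by decide, by decide, by decide, by simp⟩

end Digraph

theorem mainTheorem7 :
    (∀ k : ℕ, 2 ≤ k →
      (k ≡ 3 [MOD 6] ∨ k ≡ 5 [MOD 6]) →
      ¬ ((k : ℤ) + 2 ∣ ((Digraph.mooreBound 3 k : ℤ) - (k : ℤ) - 1) / 2) →
      Nat.Prime (Digraph.mooreBound 3 k + 1) →
      ∀ (V : Type*) (G : Digraph V), ¬ G.IsExcessOne 3 k) ∧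
    (∀ (V : Type*) (G : Digraph V), ¬ G.IsExcessOne 3 3) ∧
    (∀ (V : Type*) (G : Digraph V), ¬ G.IsExcessOne 3 15) ∧
    (∀ (V : Type*) (G : Digraph V), ¬ G.IsExcessOne 3 63) := by
  refine ⟨fun k hk hmod _ hp V G => Digraph.not_isExcessOne_three hk ?_ hp G,
    fun V G => Digraph.not_isExcessOne_three (by norm_num) (by norm_num)
      Digraph.prime_mooreBound_three_three G,
    fun V G => Digraph.not_isExcessOne_three (by norm_num) (by norm_num)
      Digraph.prime_mooreBound_three_fifteen G,
    fun V G => Digraph.not_isExcessOne_three (by norm_num) (by norm_num)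
      Digraph.prime_mooreBound_three_sixtyThree G⟩
  simp only [Nat.ModEq] at hmod
  omega
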